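/- Let $\psi=\frac{1+\sqrt5}{2}$. A Golden Riemannian manifold $(M,g,\varphi)$ is a smooth finite-dimensional manifold without boundary with a Riemannian metric $g$ and a smooth $(1,1)$-tensor field $\varphi$ such that $\varphi^2=\varphi+I$ and $g(\varphi X,Y)=g(X,\varphi Y)$ for all vector fields $X,Y$. Let $\nabla$ be the Levi-Civita connection of $g$, $R(X,Y)Z=\nabla_X\nabla_YZ-\nabla_Y\nabla_XZ-\nabla_{[X,Y]}Z$ its curvature tensor and $S(X,Y)=\sum_i g(R(E_i,X)Y,E_i)$ its Ricci tensor, where $(E_i)$ is a local orthonormal frame. The structure $\varphi$ is called integrable if $\nabla\varphi=0$. Let $M_p(c_p)$ and $M_q(c_q)$ be Riemannian manifolds of constant sectional curvature $c_p$ and $c_q$ respectively (completeness is not required). A Golden Riemannian manifold $(M,g,\varphi)$ is called a locally Golden product space form $M_p(c_p)\times M_q(c_q)$ if every point of $M$ has an open neighbourhood that is mapped by a diffeomorphism onto an open subset of $M_p\times M_q$ which is an isometry for the product metric and carries $\varphi$ to the Golden structure of the product, that is, to multiplication by $\psi$ on $TM_p$ and by $1-\psi$ on $TM_q$. (In particular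 $M=M_p\times M_q$ with the product metric and this Golden structure is allowed.) **Theorem.** Let $(M,g,\varphi)$ be a locally Golden product space form $M_p(c_p)\times M_q(c_q)$ with $\varphi$ integrable. Then $M$ is Ricci symmetric, i.e. $\nabla S=0$: for all vector fields $X,Y,Z$, $$(\nabla_ZS)(X,Y)=Z\big(S(X,Y)\big)-S(\nabla_ZX,Y)-S(X,\nabla_ZY)=0 .$$ -/

import Mathlib

open Bundle Manifold
open scoped Manifold ContDiff Topology

noncomputable section

namespace GoldenGeometry

section Single

variable {E : Type*} [NormedAddCommGroup E] [NormedSpace ℝ E] [FiniteDimensional ℝ E]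
  {H : Type*} [TopologicalSpace H] {I : ModelWithCorners ℝ E H}
  {M : Type*} [TopologicalSpace M] [ChartedSpace H M] [IsManifold I ∞ M]
  [RiemannianBundle (fun x : M ↦ TangentSpace I x)]
  [IsContMDiffRiemannianBundle I ∞ E (fun x : M ↦ TangentSpace I x)]

/-- `D` is the Levi-Civita connection of the Riemannian manifold `M`: the smooth affine connection
that is torsion-free and compatible with the metric. Recall that Mathlib writes `D Y x u` for
`(∇_u Y)(x)`. -/
structure IsLeviCivita (D : CovariantDerivative I E (fun x : M ↦ TangentSpace I x)) : Prop where
  smooth : CovariantDerivative.ContMDiffCovariantDerivative D ∞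
  torsion_free : CovariantDerivative.torsion D = 0
  metric : ∀ (x : M) (Y Z : Π y : M, TangentSpace I y), MDiffAt (T% Y) x → MDiffAt (T% Z) x →
    ∀ u : TangentSpace I x,
      mvfderiv I (fun y ↦ inner ℝ (Y y) (Z y)) x u =
        inner ℝ (D Y x u) (Z x) + inner ℝ (Y x) (D Z x u)

/-- The curvature tensor `R(u, v) w = ∇_u ∇_v w - ∇_v ∇_u w - ∇_{[u, v]} w` at the point `x`, where
the tangent vectors `u, v, w` at `x` are extended to vector fields that are smooth near `x`. -/
def curvature (D : CovariantDerivative I E (fun x : M ↦ TangentSpace I x)) (x : M)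
    (u v w : TangentSpace I x) : TangentSpace I x :=
  let U : Π y : M, TangentSpace I y := FiberBundle.extend E u
  let V : Π y : M, TangentSpace I y := FiberBundle.extend E v
  let W : Π y : M, TangentSpace I y := FiberBundle.extend E w
  D (fun y ↦ D W y (V y)) x u - D (fun y ↦ D W y (U y)) x v
    - D W x (VectorField.mlieBracket I U V x)

/-- The sectional curvature of the plane spanned by the linearly independent vectors `u, v`. -/
def sectionalCurvature (D : CovariantDerivative I E (fun x : M ↦ TangentSpace I x)) (x : M)
    (u v : TangentSpace I x) : ℝ :=
  inner ℝ (curvature D x u v v) u / (inner ℝ u u * inner ℝ v v - inner ℝ u v ^ 2)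

/-- The Ricci tensor `S(v, w) = ∑ᵢ g(R(eᵢ, v) w, eᵢ)` at `x`, with `(eᵢ)` an orthonormal basis of
the tangent space at `x`. -/
def ricci (D : CovariantDerivative I E (fun x : M ↦ TangentSpace I x)) (x : M)
    (v w : TangentSpace I x) : ℝ :=
  haveI : FiniteDimensional ℝ (TangentSpace I x) := inferInstanceAs (FiniteDimensional ℝ E)
  ∑ i, inner ℝ (curvature D x (stdOrthonormalBasis ℝ (TangentSpace I x) i) v w)
    (stdOrthonormalBasis ℝ (TangentSpace I x) i)

/-- `M` is Ricci symmetric, `∇S = 0`: for all vector fields `X, Y` the function `S(X, Y)` is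
differentiable and `(∇_w S)(X, Y) = w(S(X, Y)) - S(∇_w X, Y) - S(X, ∇_w Y)` vanishes. -/
def IsRicciSymmetric (D : CovariantDerivative I E (fun x : M ↦ TangentSpace I x)) : Prop :=
  ∀ (x : M) (X Y : Π y : M, TangentSpace I y), MDiffAt (T% X) x → MDiffAt (T% Y) x →
    MDiffAt (fun y ↦ ricci D y (X y) (Y y)) x ∧
    ∀ w : TangentSpace I x,
      mvfderiv I (fun y ↦ ricci D y (X y) (Y y)) x w
        - ricci D x (D X x w) (Y x) - ricci D x (X x) (D Y x w) = 0

/-- `φ` is a Golden structure on `M` with which the metric is compatible: a smooth `(1,1)`-tensor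
field with `φ² = φ + I` and `g(φ X, Y) = g(X, φ Y)`. -/
structure IsGoldenStructure (φ : Π x : M, TangentSpace I x →L[ℝ] TangentSpace I x) : Prop where
  smooth : ContMDiff I (I.prod 𝓘(ℝ, E →L[ℝ] E)) ∞
    (fun x ↦ TotalSpace.mk' (E →L[ℝ] E)
      (E := fun x : M ↦ TangentSpace I x →L[ℝ] TangentSpace I x) x (φ x))
  golden : ∀ (x : M) (u : TangentSpace I x), φ x (φ x u) = φ x u + u
  compatible : ∀ (x : M) (u v : TangentSpace I x), inner ℝ (φ x u) v = inner ℝ u (φ x v)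

/-- Integrability of `φ`, i.e. `∇φ = 0`: `∇_u (φ Y) = φ (∇_u Y)`. -/
def IsIntegrable (D : CovariantDerivative I E (fun x : M ↦ TangentSpace I x))
    (φ : Π x : M, TangentSpace I x →L[ℝ] TangentSpace I x) : Prop :=
  ∀ (x : M) (Y : Π y : M, TangentSpace I y), MDiffAt (T% Y) x →
    ∀ u : TangentSpace I x, D (fun y ↦ φ y (Y y)) x u = φ x (D Y x u)

variable (I M) in
/-- The Riemannian manifold `M` has constant sectional curvature `c`. -/
def IsRealSpaceForm (c : ℝ) : Prop :=
  ∃ D : CovariantDerivative I E (fun x : M ↦ TangentSpace I x), IsLeviCivita D ∧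
    ∀ (x : M) (u v : TangentSpace I x), LinearIndependent ℝ ![u, v] →
      sectionalCurvature D x u v = c

end Single

/-- `(M, g, φ)` is locally the Golden product of the Riemannian manifolds `P` and `Q`: near every
point there is a diffeomorphism `(f, h)` onto an open subset of `P × Q` that is an isometry for the
product metric and carries `φ` to the Golden structure of the product, which is multiplication by
`ψ = (1 + √5) / 2` on `TP` and by `1 - ψ` on `TQ`. -/
def IsLocallyGoldenProduct
    {E : Type*} [NormedAddCommGroup E] [NormedSpace ℝ E]
    {H : Type*} [TopologicalSpace H] (I : ModelWithCorners ℝ E H)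
    {E₁ : Type*} [NormedAddCommGroup E₁] [NormedSpace ℝ E₁]
    {H₁ : Type*} [TopologicalSpace H₁] (I₁ : ModelWithCorners ℝ E₁ H₁)
    {E₂ : Type*} [NormedAddCommGroup E₂] [NormedSpace ℝ E₂]
    {H₂ : Type*} [TopologicalSpace H₂] (I₂ : ModelWithCorners ℝ E₂ H₂)
    {M : Type*} [TopologicalSpace M] [ChartedSpace H M]
    [RiemannianBundle (fun x : M ↦ TangentSpace I x)]
    (P : Type*) [TopologicalSpace P] [ChartedSpace H₁ P]
    [RiemannianBundle (fun x : P ↦ TangentSpace I₁ x)]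
    (Q : Type*) [TopologicalSpace Q] [ChartedSpace H₂ Q]
    [RiemannianBundle (fun x : Q ↦ TangentSpace I₂ x)]
    (φ : Π x : M, TangentSpace I x →L[ℝ] TangentSpace I x) : Prop :=
  ∀ x : M, ∃ (f : M → P) (h : M → Q),
    IsLocalDiffeomorphAt I (I₁.prod I₂) ∞ (fun y ↦ (f y, h y)) x ∧
    ∀ᶠ y in 𝓝 x,
      (∀ u v : TangentSpace I y, inner ℝ u v =
        inner ℝ (mfderiv I I₁ f y u) (mfderiv I I₁ f y v)
          + inner ℝ (mfderiv I I₂ h y u) (mfderiv I I₂ h y v)) ∧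
      (∀ u : TangentSpace I y,
        mfderiv I I₁ f y (φ y u) = Real.goldenRatio • mfderiv I I₁ f y u ∧
        mfderiv I I₂ h y (φ y u) = (1 - Real.goldenRatio) • mfderiv I I₂ h y u)

end GoldenGeometry

end

set_option linter.unusedSectionVars false

namespace GoldenGeometry

section LocalFields

variable {E : Type*} [NormedAddCommGroup E] [NormedSpace ℝ E] [FiniteDimensional ℝ E]
  {H : Type*} [TopologicalSpace H] {I : ModelWithCorners ℝ E H}
  {M : Type*} [TopologicalSpace M] [ChartedSpace H M] [IsManifold I ∞ M]

/-- The vector field `W` is smooth in a neighbourhood of `x`. -/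
def SmoothNear (W : Π y : M, TangentSpace I y) (x : M) : Prop :=
  ∀ᶠ y in 𝓝 x, CMDiffAt ∞ (T% W) y

lemma SmoothNear.contMDiffAt {W : Π y : M, TangentSpace I y} {x : M} (h : SmoothNear W x) :
    CMDiffAt ∞ (T% W) x := h.self_of_nhds

lemma SmoothNear.mdiffAt {W : Π y : M, TangentSpace I y} {x : M} (h : SmoothNear W x) :
    MDiffAt (T% W) x := h.contMDiffAt.mdifferentiableAt (by simp)

lemma SmoothNear.eventually {W : Π y : M, TangentSpace I y} {x : M} (h : SmoothNear W x) :
    ∀ᶠ y in 𝓝 x, SmoothNear W y := eventually_eventually_nhds.2 h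

lemma SmoothNear.eventually_mdiffAt {W : Π y : M, TangentSpace I y} {x : M}
    (h : SmoothNear W x) : ∀ᶠ y in 𝓝 x, MDiffAt (T% W) y :=
  h.eventually.mono fun _ hy ↦ hy.mdiffAt

lemma smoothNear_extend {x : M} (u : TangentSpace I x) :
    SmoothNear (FiberBundle.extend E u : Π y : M, TangentSpace I y) x := by
  obtain ⟨s, hs, hsu⟩ := FiberBundle.exists_contMDiffOn_extend (k := ∞) I E u
  filter_upwards [eventually_mem_nhds_iff.2 hs] with y hy
  exact hsu.contMDiffAt hy

/-- A covariant derivative of class `C^∞` sends vector fields that are smooth near a point to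
sections that are smooth near that point. -/
lemma eventually_contMDiffAt_covariantDerivative [T2Space M]
    {D : CovariantDerivative I E (fun x : M ↦ TangentSpace I x)}
    (hD : CovariantDerivative.ContMDiffCovariantDerivative D ∞)
    {W : Π y : M, TangentSpace I y} {x : M} (hW : SmoothNear W x) :
    ∀ᶠ y in 𝓝 x, ContMDiffAt I (I.prod 𝓘(ℝ, E →L[ℝ] E)) ∞
      (fun y ↦ TotalSpace.mk' (E →L[ℝ] E)
        (E := fun x : M ↦ TangentSpace I x →L[ℝ] TangentSpace I x) y (D W y)) y := by
  obtain ⟨u, hu, hu_open, hxu⟩ := eventually_nhds_iff.1 hW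
  obtain ⟨χ, -, hχ⟩ := (SmoothBumpFunction.nhds_basis_tsupport (I := I) x).mem_iff.1
    (hu_open.mem_nhds hxu)
  have hWu : CMDiff[u] ∞ (T% W) := fun y hy ↦ (hu y hy).contMDiffWithinAt
  have hχW : CMDiff ∞ (T% ((χ : M → ℝ) • W)) :=
    ContMDiffOn.smul_section_of_tsupport χ.contMDiff.contMDiffOn hu_open hχ hWu
  have hDχW := hD.contMDiff.contMDiff (σ := (χ : M → ℝ) • W)
    (by simpa using hχW.contMDiffOn)
  have heq : ∀ᶠ y in 𝓝 x, ∀ᶠ z in 𝓝 y, ((χ : M → ℝ) • W) z = W z := by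
    refine eventually_eventually_nhds.2 (χ.eventuallyEq_one.mono fun z hz ↦ ?_)
    simp only [Pi.one_apply] at hz
    change χ z • W z = W z
    rw [hz, one_smul]
  have hDeq : ∀ᶠ y in 𝓝 x, D ((χ : M → ℝ) • W) y = D W y := by
    filter_upwards [heq, hW.eventually_mdiffAt] with y hy hyW
    exact (D.isCovariantDerivativeOnUniv).congr_of_eventuallyEq
      ((hχW y).mdifferentiableAt (by simp)) hyW Filter.univ_mem hy
  filter_upwards [eventually_eventually_nhds.2 hDeq] with y hy
  refine ((hDχW y (Set.mem_univ y)).contMDiffAt Filter.univ_mem).congr_of_eventuallyEq ?_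
  filter_upwards [hy] with z hz
  rw [hz]

lemma mdiffAt_covariantDerivative_apply [T2Space M]
    {D : CovariantDerivative I E (fun x : M ↦ TangentSpace I x)}
    (hD : CovariantDerivative.ContMDiffCovariantDerivative D ∞)
    {V W : Π y : M, TangentSpace I y} {x : M} (hV : MDiffAt (T% V) x) (hW : SmoothNear W x) :
    MDiffAt (T% (fun y ↦ D W y (V y))) x :=
  MDifferentiableAt.clm_bundle_apply
    (((eventually_contMDiffAt_covariantDerivative hD hW).self_of_nhds).mdifferentiableAt
      (by simp)) hV

section Coordinates

variable {E' : Type*} [NormedAddCommGroup E'] [NormedSpace ℝ E'] [FiniteDimensional ℝ E']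

variable (I) in
/-- `G` is a smooth system of coordinates near `x`, with values in the vector space `E'`. -/
def IsCoordinateSystemAt (G : M → E') (x : M) : Prop :=
  ∀ᶠ y in 𝓝 x, CMDiffAt ∞ G y ∧ (mfderiv I 𝓘(ℝ, E') G y).IsInvertible

variable (I) in
/-- The vector field with constant coefficient `a` in the coordinates `G`. -/
noncomputable def coordField (G : M → E') (a : E') : Π y : M, TangentSpace I y :=
  fun y ↦ (mfderiv I 𝓘(ℝ, E') G y).inverse a

lemma isCoordinateSystemAt_extChartAt (x : M) : IsCoordinateSystemAt I (extChartAt I x) x := by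
  filter_upwards [extChartAt_source_mem_nhds (I := I) x] with y hy
  refine ⟨contMDiffAt_extChartAt' (by simpa using hy), isInvertible_mfderiv_extChartAt hy⟩

lemma IsCoordinateSystemAt.eventually {G : M → E'} {x : M} (hG : IsCoordinateSystemAt I G x) :
    ∀ᶠ y in 𝓝 x, IsCoordinateSystemAt I G y := eventually_eventually_nhds.2 hG

/-- The constant vector field on a vector space. -/
def constField (a : E') : Π z : E', TangentSpace 𝓘(ℝ, E') z := fun _ ↦ a

lemma contMDiff_constField (a : E') : CMDiff ∞ (T% (constField a)) := fun _ ↦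
  contMDiffAt_vectorSpace_iff_contDiffAt.2 (contDiffAt_const (c := a))

lemma mlieBracket_constField (a b : E') (z : E') :
    VectorField.mlieBracket 𝓘(ℝ, E') (constField a) (constField b) z = 0 := by
  rw [← VectorField.mlieBracketWithin_univ, VectorField.mlieBracketWithin_eq_lieBracketWithin]
  change fderivWithin ℝ (fun _ : E' ↦ b) Set.univ z a
    - fderivWithin ℝ (fun _ : E' ↦ a) Set.univ z b = 0
  simp

lemma IsCoordinateSystemAt.smoothNear_coordField {G : M → E'} {x : M}
    (hG : IsCoordinateSystemAt I G x) (a : E') : SmoothNear (coordField I G a) x := by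
  filter_upwards [hG] with y hy
  exact ContMDiffAt.mpullback_vectorField_preimage (n := ∞) (contMDiff_constField a (G y))
    hy.1 hy.2 (by simp)

lemma IsCoordinateSystemAt.mfderiv_coordField {G : M → E'} {x : M}
    (hG : IsCoordinateSystemAt I G x) (a : E') :
    mfderiv I 𝓘(ℝ, E') G x (coordField I G a x) = a :=
  (hG.self_of_nhds).2.self_apply_inverse a

lemma IsCoordinateSystemAt.exists_coordField_eq {G : M → E'} {x : M}
    (hG : IsCoordinateSystemAt I G x) (u : TangentSpace I x) :
    coordField I G (mfderiv I 𝓘(ℝ, E') G x u) x = u :=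
  (hG.self_of_nhds).2.inverse_apply_self u

lemma IsCoordinateSystemAt.mlieBracket_coordField {G : M → E'} {x : M}
    (hG : IsCoordinateSystemAt I G x) (a b : E') :
    VectorField.mlieBracket I (coordField I G a) (coordField I G b) x = 0 := by
  have : IsManifold I (minSmoothness ℝ 2) M := by
    rw [minSmoothness_of_isRCLikeNormedField]; infer_instance
  have h := VectorField.mpullback_mlieBracket (I := I) (I' := 𝓘(ℝ, E')) (n := ∞) (f := G)
    (V := constField a) (W := constField b) (x₀ := x)
    ((contMDiff_constField a (G x)).mdifferentiableAt (by simp))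
    ((contMDiff_constField b (G x)).mdifferentiableAt (by simp))
    (hG.self_of_nhds).1 (by rw [minSmoothness_of_isRCLikeNormedField]; exact ENat.LEInfty.out)
  refine h.symm.trans ?_
  rw [VectorField.mpullback_apply, mlieBracket_constField, map_zero]

end Coordinates

end LocalFields

end GoldenGeometry
namespace GoldenGeometry

section DerivationFormula

variable {E : Type*} [NormedAddCommGroup E] [NormedSpace ℝ E] [FiniteDimensional ℝ E]
  {H : Type*} [TopologicalSpace H] {I : ModelWithCorners ℝ E H}
  {M : Type*} [TopologicalSpace M] [ChartedSpace H M] [IsManifold I ∞ M]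

lemma mvfderiv_comp_vectorSpace {E' : Type*} [NormedAddCommGroup E'] [NormedSpace ℝ E']
    {G : M → E'} {k : E' → ℝ} {x : M} (hk : DifferentiableAt ℝ k (G x))
    (hG : MDifferentiableAt I 𝓘(ℝ, E') G x) (v : TangentSpace I x) :
    mvfderiv I (k ∘ G) x v = fderiv ℝ k (G x) (mfderiv I 𝓘(ℝ, E') G x v) := by
  have h := mvfderiv_comp_apply (g := k) (f := G) x hk.mdifferentiableAt hG v
  rw [h]
  simp only [mvfderiv, mfderiv_eq_fderiv]
  rfl

lemma mvfderiv_congr {c c' : M → ℝ} {x : M} (h : c =ᶠ[𝓝 x] c') :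
    mvfderiv I c x = mvfderiv I c' x := by
  simp only [mvfderiv, h.mfderiv_eq]
  rw [h.self_of_nhds]

lemma mdiffAt_mfderiv_extChartAt_apply {V : Π y : M, TangentSpace I y} {x : M}
    (hV : MDiffAt (T% V) x) :
    MDifferentiableAt I 𝓘(ℝ, E)
      (fun y ↦ (mfderiv I 𝓘(ℝ, E) (extChartAt I x) y (V y) : E)) x := by
  refine ((mdifferentiableAt_section _ V).1 hV).congr_of_eventuallyEq ?_
  filter_upwards [chart_source_mem_nhds H x] with y hy
  rw [← TangentBundle.continuousLinearMapAt_trivializationAt hy]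
  exact Bundle.Trivialization.continuousLinearMapAt_apply_of_mem ℝ
    (e := trivializationAt E (TangentSpace I) x) (b := y) (by simpa using hy) (V y)

variable [I.Boundaryless]

lemma contDiffAt_comp_extChartAt_symm {c : M → ℝ} {x : M} (hc : CMDiffAt ∞ c x) :
    ContDiffAt ℝ ∞ (c ∘ (extChartAt I x).symm) (extChartAt I x x) := by
  refine ContMDiffAt.contDiffAt ?_
  refine ContMDiffAt.comp_of_eq (y := x) hc ?_ (extChartAt_to_inv x)
  exact (contMDiffOn_extChartAt_symm x).contMDiffAt (extChartAt_target_mem_nhds x)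

lemma eventually_mvfderiv_eq_fderiv {c : M → ℝ} {x : M} (hc : CMDiffAt ∞ c x) :
    ∀ᶠ y in 𝓝 x, ∀ v : TangentSpace I y, mvfderiv I c y v =
      fderiv ℝ (c ∘ (extChartAt I x).symm) (extChartAt I x y)
        (mfderiv I 𝓘(ℝ, E) (extChartAt I x) y v) := by
  have h1 : ∀ᶠ z in 𝓝 (extChartAt I x x), DifferentiableAt ℝ (c ∘ (extChartAt I x).symm) z :=
    ((((contDiffAt_comp_extChartAt_symm hc).of_le (m := 1) ENat.LEInfty.out).eventually
      (by simp)).mono fun z hz ↦ hz.differentiableAt (by simp))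
  have hs : ∀ᶠ y in 𝓝 x, ∀ᶠ z in 𝓝 y, z ∈ (extChartAt I x).source :=
    eventually_eventually_nhds.2 (extChartAt_source_mem_nhds x)
  filter_upwards [(continuousAt_extChartAt (I := I) x).eventually h1, hs] with y hy hys v
  have h2 : c =ᶠ[𝓝 y] (c ∘ (extChartAt I x).symm) ∘ extChartAt I x := by
    filter_upwards [hys] with z hz
    rw [Function.comp_apply, Function.comp_apply, (extChartAt I x).left_inv hz]
  rw [mvfderiv_congr h2]
  exact mvfderiv_comp_vectorSpace hy
    (mdifferentiableAt_extChartAt (by simpa using hys.self_of_nhds)) v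

lemma differentiableAt_fderiv_comp_extChartAt_symm {c : M → ℝ} {x : M} (hc : CMDiffAt ∞ c x) :
    DifferentiableAt ℝ (fderiv ℝ (c ∘ (extChartAt I x).symm)) (extChartAt I x x) :=
  ((contDiffAt_comp_extChartAt_symm hc).fderiv_right (m := 1)
    (by rw [one_add_one_eq_two]; exact ENat.LEInfty.out)).differentiableAt
    (by simp)

lemma mdiffAt_mvfderiv_apply {c : M → ℝ} {x : M} (hc : CMDiffAt ∞ c x)
    {V : Π y : M, TangentSpace I y} (hV : MDiffAt (T% V) x) :
    MDiffAt (fun y ↦ mvfderiv I c y (V y)) x := by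
  have h1 : MDifferentiableAt I 𝓘(ℝ, E →L[ℝ] ℝ)
      (fun y ↦ fderiv ℝ (c ∘ (extChartAt I x).symm) (extChartAt I x y)) x :=
    (differentiableAt_fderiv_comp_extChartAt_symm hc).mdifferentiableAt.comp x
      (mdifferentiableAt_extChartAt (mem_chart_source H x))
  refine (h1.clm_apply (mdiffAt_mfderiv_extChartAt_apply hV)).congr_of_eventuallyEq ?_
  filter_upwards [eventually_mvfderiv_eq_fderiv hc] with y hy using hy _

lemma mvfderiv_mvfderiv_coordField {c : M → ℝ} {x : M} (hc : CMDiffAt ∞ c x) (a b : E) :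
    mvfderiv I (fun y ↦ mvfderiv I c y (coordField I (extChartAt I x) b y)) x
      (coordField I (extChartAt I x) a x) =
    fderiv ℝ (fderiv ℝ (c ∘ (extChartAt I x).symm)) (extChartAt I x x) a b := by
  have hx := isCoordinateSystemAt_extChartAt (I := I) x
  have h : (fun y ↦ mvfderiv I c y (coordField I (extChartAt I x) b y)) =ᶠ[𝓝 x]
      (fun z ↦ fderiv ℝ (c ∘ (extChartAt I x).symm) z b) ∘ extChartAt I x := by
    filter_upwards [eventually_mvfderiv_eq_fderiv hc, hx.eventually] with y hy hyx
    rw [hy, hyx.mfderiv_coordField]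
    rfl
  have hd := differentiableAt_fderiv_comp_extChartAt_symm hc
  rw [mvfderiv_congr h, mvfderiv_comp_vectorSpace (hd.clm_apply (differentiableAt_const b))
    (mdifferentiableAt_extChartAt (mem_chart_source H x)), hx.mfderiv_coordField,
    fderiv_clm_apply hd (differentiableAt_const b)]
  simp

/-- The Lie bracket is the commutator of derivations: `U (V c) - V (U c) = [U, V] c`. -/
lemma mvfderiv_mlieBracket {c : M → ℝ} {x : M} (hc : CMDiffAt ∞ c x)
    {U V : Π y : M, TangentSpace I y} (hU : MDiffAt (T% U) x) (hV : MDiffAt (T% V) x) :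
    mvfderiv I (fun y ↦ mvfderiv I c y (V y)) x (U x)
      - mvfderiv I (fun y ↦ mvfderiv I c y (U y)) x (V x)
      = mvfderiv I c x (VectorField.mlieBracket I U V x) := by
  let Φ : (Π y : M, TangentSpace I y) → (Π y : M, TangentSpace I y) → ℝ := fun U V ↦
    mvfderiv I (fun y ↦ mvfderiv I c y (V y)) x (U x)
      - mvfderiv I (fun y ↦ mvfderiv I c y (U y)) x (V x)
      - mvfderiv I c x (VectorField.mlieBracket I U V x)
  have hanti (U V) : Φ V U = - Φ U V := by
    simp only [Φ]
    rw [VectorField.mlieBracket_swap_apply, map_neg]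
    ring
  have h₁ (V) (hV : MDiffAt (T% V) x) : TensorialAt I E (Φ · V) x := by
    constructor
    · intro f U hf hU
      have e : (fun y ↦ mvfderiv I c y ((f • U) y)) =
          fun y ↦ f y * mvfderiv I c y (U y) := by
        ext y
        change mvfderiv I c y (f y • U y) = _
        simp
      simp only [Φ, e]
      rw [mvfderiv_fun_mul hf (mdiffAt_mvfderiv_apply hc hU),
        VectorField.mlieBracket_smul_left hf hU]
      change mvfderiv I (fun y ↦ mvfderiv I c y (V y)) x (f x • U x) - _ - _ = _
      simp
      ring
    · intro U U' hU hU'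
      have e : (fun y ↦ mvfderiv I c y ((U + U') y)) =
          fun y ↦ mvfderiv I c y (U y) + mvfderiv I c y (U' y) := by
        ext y
        change mvfderiv I c y (U y + U' y) = _
        simp
      simp only [Φ, e]
      rw [mvfderiv_fun_add (mdiffAt_mvfderiv_apply hc hU) (mdiffAt_mvfderiv_apply hc hU'),
        VectorField.mlieBracket_add_left hU hU']
      change mvfderiv I (fun y ↦ mvfderiv I c y (V y)) x (U x + U' x) - _ - _ = _
      simp
      ring
  have h₂ (U) (hU : MDiffAt (T% U) x) : TensorialAt I E (Φ U ·) x := by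
    constructor
    · intro f V hf hV
      have h : Φ (f • V) U = f x • Φ V U := (h₁ U hU).smul hf hV
      rw [hanti U (f • V), hanti U V, smul_neg] at h
      exact neg_injective h
    · intro V V' hV hV'
      have h : Φ (V + V') U = Φ V U + Φ V' U := (h₁ U hU).add hV hV'
      rw [hanti U (V + V'), hanti U V, hanti U V', ← neg_add] at h
      exact neg_injective h
  have hx := isCoordinateSystemAt_extChartAt (I := I) x
  let A := coordField I (extChartAt I x) (mfderiv I 𝓘(ℝ, E) (extChartAt I x) x (U x))
  let B := coordField I (extChartAt I x) (mfderiv I 𝓘(ℝ, E) (extChartAt I x) x (V x))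
  have key : Φ U V = Φ A B := TensorialAt.pointwise₂ h₁ h₂ hU
    (hx.smoothNear_coordField _).mdiffAt hV (hx.smoothNear_coordField _).mdiffAt
    (hx.exists_coordField_eq _).symm (hx.exists_coordField_eq _).symm
  have h0 (a b : E) :
      Φ (coordField I (extChartAt I x) a) (coordField I (extChartAt I x) b) = 0 := by
    simp only [Φ]
    rw [mvfderiv_mvfderiv_coordField hc, mvfderiv_mvfderiv_coordField hc,
      hx.mlieBracket_coordField, map_zero, sub_zero, sub_eq_zero]
    exact (contDiffAt_comp_extChartAt_symm hc).isSymmSndFDerivAt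
      (by rw [minSmoothness_of_isRCLikeNormedField]; exact ENat.LEInfty.out) _ _
  exact sub_eq_zero.1 (key.trans (h0 _ _))

end DerivationFormula

end GoldenGeometry
namespace GoldenGeometry

section Curvature

variable {E : Type*} [NormedAddCommGroup E] [NormedSpace ℝ E] [FiniteDimensional ℝ E]
  {H : Type*} [TopologicalSpace H] {I : ModelWithCorners ℝ E H}
  {M : Type*} [TopologicalSpace M] [ChartedSpace H M] [IsManifold I ∞ M]
  [RiemannianBundle (fun x : M ↦ TangentSpace I x)]
  [IsContMDiffRiemannianBundle I ∞ E (fun x : M ↦ TangentSpace I x)]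
  {D : CovariantDerivative I E (fun x : M ↦ TangentSpace I x)}

lemma mdiffAt_inner {W Z : Π y : M, TangentSpace I y} {x : M} (hW : MDiffAt (T% W) x)
    (hZ : MDiffAt (T% Z) x) : MDiffAt (fun y ↦ inner ℝ (W y) (Z y)) x :=
  MDifferentiableAt.inner_bundle hW hZ

variable [I.Boundaryless] [T2Space M]

/-- The curvature operator `∇_U ∇_V W - ∇_V ∇_U W - ∇_{[U, V]} W` on vector fields. -/
noncomputable def curvatureOp (D : CovariantDerivative I E (fun x : M ↦ TangentSpace I x))
    (U V W : Π y : M, TangentSpace I y) (x : M) : TangentSpace I x :=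
  D (fun y ↦ D W y (V y)) x (U x) - D (fun y ↦ D W y (U y)) x (V x)
    - D W x (VectorField.mlieBracket I U V x)

lemma curvature_eq_curvatureOp (x : M) (u v w : TangentSpace I x) :
    curvature D x u v w = curvatureOp D (FiberBundle.extend E u) (FiberBundle.extend E v)
      (FiberBundle.extend E w) x := by
  simp [curvature, curvatureOp]

lemma curvatureOp_swap (U V W : Π y : M, TangentSpace I y) (x : M) :
    curvatureOp D V U W x = - curvatureOp D U V W x := by
  simp only [curvatureOp]
  rw [VectorField.mlieBracket_swap_apply, map_neg]
  abel

lemma tensorialAt_curvatureOp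
    (hD : CovariantDerivative.ContMDiffCovariantDerivative D ∞) {x : M}
    (V : Π y : M, TangentSpace I y) {W : Π y : M, TangentSpace I y} (hW : SmoothNear W x) :
    TensorialAt I E (fun U ↦ curvatureOp D U V W x) x := by
  have hd := D.isCovariantDerivativeOnUniv
  constructor
  · intro f U hf hU
    have e : (fun y ↦ D W y ((f • U) y)) = f • fun y ↦ D W y (U y) := by
      ext y
      exact (D W y).map_smul (f y) (U y)
    simp only [curvatureOp]
    rw [e, hd.leibniz (mdiffAt_covariantDerivative_apply hD hU hW) hf,
      VectorField.mlieBracket_smul_left hf hU]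
    change D (fun y ↦ D W y (V y)) x (f x • U x) - _ - _ = _
    simp
    module
  · intro U U' hU hU'
    have e : (fun y ↦ D W y ((U + U') y)) =
        (fun y ↦ D W y (U y)) + fun y ↦ D W y (U' y) := by
      ext y
      exact (D W y).map_add (U y) (U' y)
    simp only [curvatureOp]
    rw [e, hd.add (mdiffAt_covariantDerivative_apply hD hU hW)
        (mdiffAt_covariantDerivative_apply hD hU' hW),
      VectorField.mlieBracket_add_left hU hU']
    change D (fun y ↦ D W y (V y)) x (U x + U' x) - _ - _ = _
    simp
    module

lemma SmoothNear.contMDiffAt_inner {W Z : Π y : M, TangentSpace I y} {x : M}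
    (hW : SmoothNear W x) (hZ : SmoothNear Z x) :
    CMDiffAt ∞ (fun y ↦ inner ℝ (W y) (Z y)) x :=
  ContMDiffAt.inner_bundle hW.contMDiffAt hZ.contMDiffAt

/-- The second derivative of `g(W, Z)`. -/
lemma IsLeviCivita.mvfderiv_mvfderiv_inner (hD : IsLeviCivita D) {x : M}
    {V W Z : Π y : M, TangentSpace I y} (hV : SmoothNear V x)
    (hW : SmoothNear W x) (hZ : SmoothNear Z x) (u : TangentSpace I x) :
    mvfderiv I (fun y ↦ mvfderiv I (fun z ↦ inner ℝ (W z) (Z z)) y (V y)) x u =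
      inner ℝ (D (fun y ↦ D W y (V y)) x u) (Z x) + inner ℝ (D W x (V x)) (D Z x u)
      + (inner ℝ (D W x u) (D Z x (V x)) + inner ℝ (W x) (D (fun y ↦ D Z y (V y)) x u)) := by
  have e : (fun y ↦ mvfderiv I (fun z ↦ inner ℝ (W z) (Z z)) y (V y)) =ᶠ[𝓝 x]
      fun y ↦ inner ℝ (D W y (V y)) (Z y) + inner ℝ (W y) (D Z y (V y)) := by
    filter_upwards [hW.eventually_mdiffAt, hZ.eventually_mdiffAt] with y hy hy'
    exact hD.metric y W Z hy hy' (V y)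
  have hVW := mdiffAt_covariantDerivative_apply hD.smooth hV.mdiffAt hW
  have hVZ := mdiffAt_covariantDerivative_apply hD.smooth hV.mdiffAt hZ
  rw [mvfderiv_congr e, mvfderiv_fun_add (mdiffAt_inner hVW hZ.mdiffAt)
    (mdiffAt_inner hW.mdiffAt hVZ), add_apply]
  rw [hD.metric x _ _ hVW hZ.mdiffAt, hD.metric x _ _ hW.mdiffAt hVZ]

lemma IsLeviCivita.inner_curvatureOp_skew (hD : IsLeviCivita D) {x : M}
    {U V W Z : Π y : M, TangentSpace I y} (hU : SmoothNear U x) (hV : SmoothNear V x)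
    (hW : SmoothNear W x) (hZ : SmoothNear Z x) :
    inner ℝ (curvatureOp D U V W x) (Z x) = - inner ℝ (W x) (curvatureOp D U V Z x) := by
  have h := mvfderiv_mlieBracket (hW.contMDiffAt_inner hZ) hU.mdiffAt hV.mdiffAt
  rw [hD.mvfderiv_mvfderiv_inner hV hW hZ, hD.mvfderiv_mvfderiv_inner hU hW hZ,
    hD.metric x _ _ hW.mdiffAt hZ.mdiffAt] at h
  simp only [curvatureOp, inner_sub_left, inner_sub_right]
  linarith

/-- The curvature operator is a tensor. -/
lemma IsLeviCivita.curvatureOp_congr (hD : IsLeviCivita D) {x : M}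
    {U V W U' V' W' : Π y : M, TangentSpace I y} (hU : SmoothNear U x) (hV : SmoothNear V x)
    (hW : SmoothNear W x) (hU' : SmoothNear U' x) (hV' : SmoothNear V' x)
    (hW' : SmoothNear W' x) (eU : U x = U' x) (eV : V x = V' x) (eW : W x = W' x) :
    curvatureOp D U V W x = curvatureOp D U' V' W' x := by
  have h1 : curvatureOp D U V W x = curvatureOp D U' V W x :=
    (tensorialAt_curvatureOp hD.smooth V hW).pointwise hU.mdiffAt hU'.mdiffAt eU
  have h2 : curvatureOp D V U' W x = curvatureOp D V' U' W x :=
    (tensorialAt_curvatureOp hD.smooth U' hW).pointwise hV.mdiffAt hV'.mdiffAt eV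
  have h3 : curvatureOp D U' V' W x = curvatureOp D U' V' W' x := by
    refine ext_inner_right ℝ fun z ↦ ?_
    have hz := smoothNear_extend (I := I) z
    have e1 := hD.inner_curvatureOp_skew hU' hV' hW hz
    have e2 := hD.inner_curvatureOp_skew hU' hV' hW' hz
    rw [FiberBundle.extend_apply_self] at e1 e2
    rw [e1, e2, eW]
  rw [h1, ← h3, curvatureOp_swap, h2, ← curvatureOp_swap]

lemma IsLeviCivita.curvature_eq (hD : IsLeviCivita D) {x : M}
    {U V W : Π y : M, TangentSpace I y} (hU : SmoothNear U x) (hV : SmoothNear V x)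
    (hW : SmoothNear W x) : curvature D x (U x) (V x) (W x) = curvatureOp D U V W x := by
  rw [curvature_eq_curvatureOp]
  exact hD.curvatureOp_congr (smoothNear_extend _) (smoothNear_extend _) (smoothNear_extend _)
    hU hV hW (by simp) (by simp) (by simp)

lemma curvature_swap (x : M) (u v w : TangentSpace I x) :
    curvature D x v u w = - curvature D x u v w := by
  rw [curvature_eq_curvatureOp, curvature_eq_curvatureOp, curvatureOp_swap]

lemma IsLeviCivita.inner_curvature_skew (hD : IsLeviCivita D) (x : M)
    (u v w z : TangentSpace I x) :
    inner ℝ (curvature D x u v w) z = - inner ℝ (curvature D x u v z) w := by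
  have h := hD.inner_curvatureOp_skew (smoothNear_extend u) (smoothNear_extend v)
    (smoothNear_extend w) (smoothNear_extend z)
  rw [FiberBundle.extend_apply_self, FiberBundle.extend_apply_self] at h
  rw [curvature_eq_curvatureOp, curvature_eq_curvatureOp, h, real_inner_comm]

lemma IsLeviCivita.curvature_add_left (hD : IsLeviCivita D) (x : M)
    (u u' v w : TangentSpace I x) :
    curvature D x (u + u') v w = curvature D x u v w + curvature D x u' v w := by
  have hT := tensorialAt_curvatureOp hD.smooth (FiberBundle.extend E v) (smoothNear_extend w)
  have h := hT.add (smoothNear_extend u).mdiffAt (smoothNear_extend u').mdiffAt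
  simp only [curvature_eq_curvatureOp]
  rw [← h]
  exact hT.pointwise (smoothNear_extend _).mdiffAt
    (mdifferentiableAt_add_section (smoothNear_extend u).mdiffAt (smoothNear_extend u').mdiffAt)
    (by simp)

lemma IsLeviCivita.curvature_smul_left (hD : IsLeviCivita D) (x : M) (a : ℝ)
    (u v w : TangentSpace I x) :
    curvature D x (a • u) v w = a • curvature D x u v w := by
  have hT := tensorialAt_curvatureOp hD.smooth (FiberBundle.extend E v) (smoothNear_extend w)
  have h := hT.smul (f := fun _ ↦ a) mdifferentiableAt_const (smoothNear_extend u).mdiffAt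
  simp only [curvature_eq_curvatureOp]
  rw [← h]
  exact hT.pointwise (smoothNear_extend _).mdiffAt
    (mdifferentiableAt_const.smul_section (smoothNear_extend u).mdiffAt) (by simp)

lemma IsLeviCivita.curvature_add_middle (hD : IsLeviCivita D) (x : M)
    (u v v' w : TangentSpace I x) :
    curvature D x u (v + v') w = curvature D x u v w + curvature D x u v' w := by
  rw [curvature_swap, hD.curvature_add_left, curvature_swap x u v, curvature_swap x u v']
  abel

lemma IsLeviCivita.curvature_smul_middle (hD : IsLeviCivita D) (x : M) (a : ℝ)
    (u v w : TangentSpace I x) :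
    curvature D x u (a • v) w = a • curvature D x u v w := by
  rw [curvature_swap, hD.curvature_smul_left, curvature_swap x u v, smul_neg, neg_neg]

lemma IsLeviCivita.curvature_add_right (hD : IsLeviCivita D) (x : M)
    (u v w w' : TangentSpace I x) :
    curvature D x u v (w + w') = curvature D x u v w + curvature D x u v w' := by
  refine ext_inner_right ℝ fun z ↦ ?_
  rw [hD.inner_curvature_skew, inner_add_left, inner_add_right, hD.inner_curvature_skew x u v w,
    hD.inner_curvature_skew x u v w']
  ring

lemma IsLeviCivita.sub_eq_mlieBracket (hD : IsLeviCivita D) {x : M}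
    {U V : Π y : M, TangentSpace I y} (hU : MDiffAt (T% U) x) (hV : MDiffAt (T% V) x) :
    D V x (U x) - D U x (V x) = VectorField.mlieBracket I U V x :=
  D.torsion_eq_zero_iff.1 hD.torsion_free hU hV

/-- The first Bianchi identity. -/
lemma IsLeviCivita.bianchi (hD : IsLeviCivita D) (x : M) (u v w : TangentSpace I x) :
    curvature D x u v w + curvature D x v w u + curvature D x w u v = 0 := by
  have hx := isCoordinateSystemAt_extChartAt (I := I) x
  obtain ⟨U, hU⟩ : ∃ a : E, coordField I (extChartAt I x) a x = u :=
    ⟨_, hx.exists_coordField_eq u⟩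
  obtain ⟨V, hV⟩ : ∃ a : E, coordField I (extChartAt I x) a x = v :=
    ⟨_, hx.exists_coordField_eq v⟩
  obtain ⟨W, hW⟩ : ∃ a : E, coordField I (extChartAt I x) a x = w :=
    ⟨_, hx.exists_coordField_eq w⟩
  subst hU hV hW
  have hs (a : E) := hx.smoothNear_coordField a
  have hcomm (a b : E) : D (fun y ↦ D (coordField I (extChartAt I x) a) y
      (coordField I (extChartAt I x) b y)) x = D (fun y ↦ D (coordField I (extChartAt I x) b) y
      (coordField I (extChartAt I x) a y)) x := by
    refine D.isCovariantDerivativeOnUniv.congr_of_eventuallyEq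
      (mdiffAt_covariantDerivative_apply hD.smooth (hs b).mdiffAt (hs a))
      (mdiffAt_covariantDerivative_apply hD.smooth (hs a).mdiffAt (hs b)) Filter.univ_mem ?_
    filter_upwards [hx.eventually] with y hy
    have h := hD.sub_eq_mlieBracket (hy.smoothNear_coordField b).mdiffAt
      (hy.smoothNear_coordField a).mdiffAt
    rw [hy.mlieBracket_coordField] at h
    exact sub_eq_zero.1 h
  rw [hD.curvature_eq (hs _) (hs _) (hs _), hD.curvature_eq (hs _) (hs _) (hs _),
    hD.curvature_eq (hs _) (hs _) (hs _)]
  simp only [curvatureOp, hx.mlieBracket_coordField, map_zero]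
  rw [hcomm U V, hcomm V W, hcomm W U]
  abel

/-- The pair symmetry of the curvature tensor. -/
lemma IsLeviCivita.inner_curvature_pair_symm (hD : IsLeviCivita D) (x : M)
    (u v w z : TangentSpace I x) :
    inner ℝ (curvature D x u v w) z = inner ℝ (curvature D x w z u) v := by
  have hb (a b c d : TangentSpace I x) : inner ℝ (curvature D x a b c) d
      + inner ℝ (curvature D x b c a) d + inner ℝ (curvature D x c a b) d = 0 := by
    rw [← inner_add_left, ← inner_add_left, hD.bianchi, inner_zero_left]
  have hs := hD.inner_curvature_skew x
  have ha (a b c d : TangentSpace I x) :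
      inner ℝ (curvature D x b a c) d = - inner ℝ (curvature D x a b c) d := by
    rw [curvature_swap x a b, inner_neg_left]
  linarith [hb u v w z, hb v w z u, hb w z u v, hb z u v w, hs u v w z, hs v w u z, hs w u v z,
    hs v w z u, hs w z v u, hs z v w u, hs w z u v, hs z u w v, hs u w z v, hs z u v w,
    hs u v z w, hs v z u w, ha u v w z, ha v w z u, ha w u v z, ha u w z v, ha z v w u,
    ha v z w u, ha v z u w, ha w z u v, ha z u v w]

end Curvature

end GoldenGeometry
namespace GoldenGeometry

section Koszul

variable {E : Type*} [NormedAddCommGroup E] [NormedSpace ℝ E] [FiniteDimensional ℝ E]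
  {H : Type*} [TopologicalSpace H] {I : ModelWithCorners ℝ E H}
  {M : Type*} [TopologicalSpace M] [ChartedSpace H M] [IsManifold I ∞ M]
  [RiemannianBundle (fun x : M ↦ TangentSpace I x)]
  [IsContMDiffRiemannianBundle I ∞ E (fun x : M ↦ TangentSpace I x)]
  {D : CovariantDerivative I E (fun x : M ↦ TangentSpace I x)}

/-- The Koszul formula for commuting vector fields. -/
lemma IsLeviCivita.koszul (hD : IsLeviCivita D) {x : M} {X Y Z : Π y : M, TangentSpace I y}
    (hX : MDiffAt (T% X) x) (hY : MDiffAt (T% Y) x) (hZ : MDiffAt (T% Z) x)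
    (hXY : VectorField.mlieBracket I X Y x = 0) (hXZ : VectorField.mlieBracket I X Z x = 0)
    (hYZ : VectorField.mlieBracket I Y Z x = 0) :
    2 * inner ℝ (D Y x (X x)) (Z x) = mvfderiv I (fun y ↦ inner ℝ (Y y) (Z y)) x (X x)
      + mvfderiv I (fun y ↦ inner ℝ (X y) (Z y)) x (Y x)
      - mvfderiv I (fun y ↦ inner ℝ (X y) (Y y)) x (Z x) := by
  have h {U V : Π y : M, TangentSpace I y} (hU : MDiffAt (T% U) x) (hV : MDiffAt (T% V) x)
      (h0 : VectorField.mlieBracket I U V x = 0) : D V x (U x) = D U x (V x) :=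
    sub_eq_zero.1 ((D.torsion_eq_zero_iff.1 hD.torsion_free hU hV).trans h0)
  rw [hD.metric x _ _ hY hZ, hD.metric x _ _ hX hZ, hD.metric x _ _ hX hY, ← h hX hY hXY,
    ← h hX hZ hXZ, ← h hY hZ hYZ,
    real_inner_comm (Y x) (D Z x (X x))]
  ring

end Koszul

section Product

variable {E : Type*} [NormedAddCommGroup E] [NormedSpace ℝ E] [FiniteDimensional ℝ E]
  {H : Type*} [TopologicalSpace H] {I : ModelWithCorners ℝ E H}
  {E₁ : Type*} [NormedAddCommGroup E₁] [NormedSpace ℝ E₁] [FiniteDimensional ℝ E₁]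
  {H₁ : Type*} [TopologicalSpace H₁] {I₁ : ModelWithCorners ℝ E₁ H₁}
  {E₂ : Type*} [NormedAddCommGroup E₂] [NormedSpace ℝ E₂] [FiniteDimensional ℝ E₂]
  {H₂ : Type*} [TopologicalSpace H₂] {I₂ : ModelWithCorners ℝ E₂ H₂}
  {M : Type*} [TopologicalSpace M] [ChartedSpace H M] [IsManifold I ∞ M]
  [RiemannianBundle (fun x : M ↦ TangentSpace I x)]
  [IsContMDiffRiemannianBundle I ∞ E (fun x : M ↦ TangentSpace I x)]
  {P : Type*} [TopologicalSpace P] [ChartedSpace H₁ P] [IsManifold I₁ ∞ P]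
  [RiemannianBundle (fun x : P ↦ TangentSpace I₁ x)]
  [IsContMDiffRiemannianBundle I₁ ∞ E₁ (fun x : P ↦ TangentSpace I₁ x)]
  {Q : Type*} [TopologicalSpace Q] [ChartedSpace H₂ Q] [IsManifold I₂ ∞ Q]
  [RiemannianBundle (fun x : Q ↦ TangentSpace I₂ x)]
  [IsContMDiffRiemannianBundle I₂ ∞ E₂ (fun x : Q ↦ TangentSpace I₂ x)]
  {f : M → P} {h : M → Q} {x : M} {G₁ : P → E₁} {G₂ : Q → E₂}

variable (I I₁ I₂) in
/-- Near `x`, the map `(f, h)` is a local isometry into the Riemannian product `P × Q`. -/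
def IsProductIsometryAt (f : M → P) (h : M → Q) (x : M) : Prop :=
  IsLocalDiffeomorphAt I (I₁.prod I₂) ∞ (fun y ↦ (f y, h y)) x ∧
    ∀ᶠ y in 𝓝 x, ∀ u v : TangentSpace I y, inner ℝ u v =
      inner ℝ (mfderiv I I₁ f y u) (mfderiv I I₁ f y v)
        + inner ℝ (mfderiv I I₂ h y u) (mfderiv I I₂ h y v)

lemma IsProductIsometryAt.eventually (hF : IsProductIsometryAt I I₁ I₂ f h x) :
    ∀ᶠ y in 𝓝 x, IsProductIsometryAt I I₁ I₂ f h y := by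
  obtain ⟨⟨Φ, hx, hΦ⟩, hiso⟩ := hF
  filter_upwards [Φ.open_source.mem_nhds hx, eventually_eventually_nhds.2 hiso] with y hy hy'
  exact ⟨⟨Φ, hy, hΦ⟩, hy'⟩

lemma IsProductIsometryAt.inner_eq (hF : IsProductIsometryAt I I₁ I₂ f h x)
    (u v : TangentSpace I x) : inner ℝ u v =
      inner ℝ (mfderiv I I₁ f x u) (mfderiv I I₁ f x v)
        + inner ℝ (mfderiv I I₂ h x u) (mfderiv I I₂ h x v) :=
  hF.2.self_of_nhds u v

lemma IsProductIsometryAt.contMDiffAt_fst (hF : IsProductIsometryAt I I₁ I₂ f h x) :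
    CMDiffAt ∞ f x := hF.1.contMDiffAt.fst

lemma IsProductIsometryAt.contMDiffAt_snd (hF : IsProductIsometryAt I I₁ I₂ f h x) :
    CMDiffAt ∞ h x := hF.1.contMDiffAt.snd

lemma IsProductIsometryAt.mdiffAt_fst (hF : IsProductIsometryAt I I₁ I₂ f h x) :
    MDiffAt f x := hF.contMDiffAt_fst.mdifferentiableAt (by simp)

lemma IsProductIsometryAt.mdiffAt_snd (hF : IsProductIsometryAt I I₁ I₂ f h x) :
    MDiffAt h x := hF.contMDiffAt_snd.mdifferentiableAt (by simp)

lemma IsProductIsometryAt.exists_mfderiv_equiv (hF : IsProductIsometryAt I I₁ I₂ f h x) :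
    ∃ L : TangentSpace I x ≃L[ℝ] TangentSpace I₁ (f x) × TangentSpace I₂ (h x),
      ∀ u, L u = (mfderiv I I₁ f x u, mfderiv I I₂ h x u) := by
  refine ⟨hF.1.mfderivToContinuousLinearEquiv (by simp), fun u ↦ ?_⟩
  change mfderiv I (I₁.prod I₂) (fun y ↦ (f y, h y)) x u = _
  rw [mfderiv_prodMk hF.mdiffAt_fst hF.mdiffAt_snd]
  rfl

lemma IsProductIsometryAt.exists_mfderiv_eq (hF : IsProductIsometryAt I I₁ I₂ f h x)
    (u₁ : TangentSpace I₁ (f x)) (u₂ : TangentSpace I₂ (h x)) :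
    ∃ u : TangentSpace I x, mfderiv I I₁ f x u = u₁ ∧ mfderiv I I₂ h x u = u₂ := by
  obtain ⟨L, hL⟩ := hF.exists_mfderiv_equiv
  refine ⟨L.symm (u₁, u₂), ?_⟩
  have := hL (L.symm (u₁, u₂))
  rw [L.apply_symm_apply, Prod.mk.injEq] at this
  exact ⟨this.1.symm, this.2.symm⟩

/-- The coordinates on `M` induced by coordinates on `P` and `Q` along the maps `f` and `h`. -/
def prodCoord (f : M → P) (h : M → Q) (G₁ : P → E₁) (G₂ : Q → E₂) : M → E₁ × E₂ :=
  fun y ↦ (G₁ (f y), G₂ (h y))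

lemma mfderiv_prodCoord (hf : MDifferentiableAt I I₁ f x) (hh : MDifferentiableAt I I₂ h x)
    (hG₁ : IsCoordinateSystemAt I₁ G₁ (f x)) (hG₂ : IsCoordinateSystemAt I₂ G₂ (h x))
    (u : TangentSpace I x) :
    mfderiv I 𝓘(ℝ, E₁ × E₂) (prodCoord f h G₁ G₂) x u =
      ((mfderiv I₁ 𝓘(ℝ, E₁) G₁ (f x) (mfderiv I I₁ f x u) : E₁),
        (mfderiv I₂ 𝓘(ℝ, E₂) G₂ (h x) (mfderiv I I₂ h x u) : E₂)) := by
  have h₁ : MDifferentiableAt I₁ 𝓘(ℝ, E₁) G₁ (f x) :=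
    (hG₁.self_of_nhds).1.mdifferentiableAt (by simp)
  have h₂ : MDifferentiableAt I₂ 𝓘(ℝ, E₂) G₂ (h x) :=
    (hG₂.self_of_nhds).1.mdifferentiableAt (by simp)
  have d₁ := (h₁.comp x hf).hasMFDerivAt
  have d₂ := (h₂.comp x hh).hasMFDerivAt
  have d : HasMFDerivAt I 𝓘(ℝ, E₁ × E₂) (prodCoord f h G₁ G₂) x
      (ContinuousLinearMap.prod (M₂ := E₁) (M₃ := E₂) (mfderiv I 𝓘(ℝ, E₁) (G₁ ∘ f) x)
        (mfderiv I 𝓘(ℝ, E₂) (G₂ ∘ h) x)) := ⟨d₁.1.prodMk d₂.1, d₁.2.prodMk d₂.2⟩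
  rw [d.mfderiv, ← mfderiv_comp_apply x h₁ hf, ← mfderiv_comp_apply x h₂ hh]
  rfl

lemma IsProductIsometryAt.isCoordinateSystemAt_prodCoord
    (hF : IsProductIsometryAt I I₁ I₂ f h x)
    (hG₁ : IsCoordinateSystemAt I₁ G₁ (f x)) (hG₂ : IsCoordinateSystemAt I₂ G₂ (h x)) :
    IsCoordinateSystemAt I (prodCoord f h G₁ G₂) x := by
  filter_upwards [hF.eventually, hF.mdiffAt_fst.continuousAt.eventually hG₁.eventually,
    hF.mdiffAt_snd.continuousAt.eventually hG₂.eventually] with y hFy h₁ h₂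
  refine ⟨?_, ?_⟩
  · exact ((h₁.self_of_nhds).1.comp y hFy.contMDiffAt_fst).prodMk_space
      ((h₂.self_of_nhds).1.comp y hFy.contMDiffAt_snd)
  · obtain ⟨L, hL⟩ := hFy.exists_mfderiv_equiv
    obtain ⟨L₁, hL₁⟩ := (h₁.self_of_nhds).2
    obtain ⟨L₂, hL₂⟩ := (h₂.self_of_nhds).2
    refine ⟨L.trans (L₁.prodCongr L₂), ?_⟩
    ext1 u
    rw [mfderiv_prodCoord hFy.mdiffAt_fst hFy.mdiffAt_snd h₁ h₂, ← hL₁, ← hL₂]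
    change (L₁ (L u).1, L₂ (L u).2) = _
    rw [hL]
    rfl

lemma IsProductIsometryAt.mfderiv_coordField_prodCoord
    (hF : IsProductIsometryAt I I₁ I₂ f h x)
    (hG₁ : IsCoordinateSystemAt I₁ G₁ (f x)) (hG₂ : IsCoordinateSystemAt I₂ G₂ (h x))
    (a : E₁ × E₂) :
    mfderiv I I₁ f x (coordField I (prodCoord f h G₁ G₂) a x) = coordField I₁ G₁ a.1 (f x) ∧
    mfderiv I I₂ h x (coordField I (prodCoord f h G₁ G₂) a x) = coordField I₂ G₂ a.2 (h x) := by
  have e := (hF.isCoordinateSystemAt_prodCoord hG₁ hG₂).mfderiv_coordField a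
  rw [mfderiv_prodCoord hF.mdiffAt_fst hF.mdiffAt_snd hG₁ hG₂] at e
  constructor
  · refine (hG₁.exists_coordField_eq _).symm.trans ?_
    exact congrArg (fun b : E₁ ↦ coordField I₁ G₁ b (f x)) (congrArg Prod.fst e)
  · refine (hG₂.exists_coordField_eq _).symm.trans ?_
    exact congrArg (fun b : E₂ ↦ coordField I₂ G₂ b (h x)) (congrArg Prod.snd e)

variable (I I₁ I₂) in
/-- The vector field `X` on `M` is related to the vector fields `X₁` on `P` and `X₂` on `Q` by the
maps `f` and `h`, in a neighbourhood of `x`. -/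
def RelatedNear (f : M → P) (h : M → Q) (X : Π y : M, TangentSpace I y)
    (X₁ : Π y : P, TangentSpace I₁ y) (X₂ : Π y : Q, TangentSpace I₂ y) (x : M) : Prop :=
  ∀ᶠ y in 𝓝 x, mfderiv I I₁ f y (X y) = X₁ (f y) ∧ mfderiv I I₂ h y (X y) = X₂ (h y)

lemma IsProductIsometryAt.relatedNear_coordField (hF : IsProductIsometryAt I I₁ I₂ f h x)
    (hG₁ : IsCoordinateSystemAt I₁ G₁ (f x)) (hG₂ : IsCoordinateSystemAt I₂ G₂ (h x))
    (a : E₁ × E₂) :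
    RelatedNear I I₁ I₂ f h (coordField I (prodCoord f h G₁ G₂) a) (coordField I₁ G₁ a.1)
      (coordField I₂ G₂ a.2) x := by
  filter_upwards [hF.eventually, hF.mdiffAt_fst.continuousAt.eventually hG₁.eventually,
    hF.mdiffAt_snd.continuousAt.eventually hG₂.eventually] with y hFy h₁ h₂
  exact hFy.mfderiv_coordField_prodCoord h₁ h₂ a

lemma IsProductIsometryAt.mvfderiv_inner (hF : IsProductIsometryAt I I₁ I₂ f h x)
    {Y Z : Π y : M, TangentSpace I y} {Y₁ Z₁ : Π y : P, TangentSpace I₁ y}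
    {Y₂ Z₂ : Π y : Q, TangentSpace I₂ y} (hY : RelatedNear I I₁ I₂ f h Y Y₁ Y₂ x)
    (hZ : RelatedNear I I₁ I₂ f h Z Z₁ Z₂ x) (hY₁ : MDiffAt (T% Y₁) (f x))
    (hZ₁ : MDiffAt (T% Z₁) (f x)) (hY₂ : MDiffAt (T% Y₂) (h x)) (hZ₂ : MDiffAt (T% Z₂) (h x))
    (u : TangentSpace I x) :
    mvfderiv I (fun y ↦ inner ℝ (Y y) (Z y)) x u =
      mvfderiv I₁ (fun y ↦ inner ℝ (Y₁ y) (Z₁ y)) (f x) (mfderiv I I₁ f x u)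
      + mvfderiv I₂ (fun y ↦ inner ℝ (Y₂ y) (Z₂ y)) (h x) (mfderiv I I₂ h x u) := by
  have e : (fun y ↦ inner ℝ (Y y) (Z y)) =ᶠ[𝓝 x]
      fun y ↦ ((fun p ↦ inner ℝ (Y₁ p) (Z₁ p)) ∘ f) y
        + ((fun q ↦ inner ℝ (Y₂ q) (Z₂ q)) ∘ h) y := by
    filter_upwards [hF.eventually, hY, hZ] with y hFy hYy hZy
    rw [hFy.inner_eq, hYy.1, hYy.2, hZy.1, hZy.2]
    rfl
  have h₁ := mdiffAt_inner hY₁ hZ₁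
  have h₂ := mdiffAt_inner hY₂ hZ₂
  rw [mvfderiv_congr e, mvfderiv_fun_add (h₁.comp x hF.mdiffAt_fst) (h₂.comp x hF.mdiffAt_snd),
    add_apply, mvfderiv_comp_apply x h₁ hF.mdiffAt_fst, mvfderiv_comp_apply x h₂ hF.mdiffAt_snd]

variable {D : CovariantDerivative I E (fun x : M ↦ TangentSpace I x)}
  {D₁ : CovariantDerivative I₁ E₁ (fun x : P ↦ TangentSpace I₁ x)}
  {D₂ : CovariantDerivative I₂ E₂ (fun x : Q ↦ TangentSpace I₂ x)}

/-- The Levi-Civita connection of a product is the product of the Levi-Civita connections, on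
coordinate fields. -/
lemma IsProductIsometryAt.mfderiv_covariantDerivative (hF : IsProductIsometryAt I I₁ I₂ f h x)
    (hD : IsLeviCivita D) (hD₁ : IsLeviCivita D₁) (hD₂ : IsLeviCivita D₂)
    (hG₁ : IsCoordinateSystemAt I₁ G₁ (f x)) (hG₂ : IsCoordinateSystemAt I₂ G₂ (h x))
    (a b : E₁ × E₂) :
    mfderiv I I₁ f x (D (coordField I (prodCoord f h G₁ G₂) b) x
        (coordField I (prodCoord f h G₁ G₂) a x)) =
      D₁ (coordField I₁ G₁ b.1) (f x) (coordField I₁ G₁ a.1 (f x)) ∧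
    mfderiv I I₂ h x (D (coordField I (prodCoord f h G₁ G₂) b) x
        (coordField I (prodCoord f h G₁ G₂) a x)) =
      D₂ (coordField I₂ G₂ b.2) (h x) (coordField I₂ G₂ a.2 (h x)) := by
  obtain ⟨s, hs₁, hs₂⟩ := hF.exists_mfderiv_eq
    (D₁ (coordField I₁ G₁ b.1) (f x) (coordField I₁ G₁ a.1 (f x)))
    (D₂ (coordField I₂ G₂ b.2) (h x) (coordField I₂ G₂ a.2 (h x)))
  have hG := hF.isCoordinateSystemAt_prodCoord hG₁ hG₂
  have hd (c) := (hG.smoothNear_coordField c).mdiffAt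
  have hd₁ (c) := (hG₁.smoothNear_coordField c).mdiffAt
  have hd₂ (c) := (hG₂.smoothNear_coordField c).mdiffAt
  have hr (c) := hF.relatedNear_coordField hG₁ hG₂ c
  have hi (c d) := hF.mvfderiv_inner (hr c) (hr d) (hd₁ _) (hd₁ _) (hd₂ _) (hd₂ _)
  have key : D (coordField I (prodCoord f h G₁ G₂) b) x
      (coordField I (prodCoord f h G₁ G₂) a x) = s := by
    refine ext_inner_right ℝ fun z ↦ ?_
    obtain ⟨c, rfl⟩ : ∃ c : E₁ × E₂, coordField I (prodCoord f h G₁ G₂) c x = z :=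
      ⟨_, hG.exists_coordField_eq z⟩
    have hm (d) := hF.mfderiv_coordField_prodCoord hG₁ hG₂ d
    have k := hD.koszul (hd a) (hd b) (hd c) (hG.mlieBracket_coordField _ _)
      (hG.mlieBracket_coordField _ _) (hG.mlieBracket_coordField _ _)
    have k₁ := hD₁.koszul (hd₁ a.1) (hd₁ b.1) (hd₁ c.1) (hG₁.mlieBracket_coordField _ _)
      (hG₁.mlieBracket_coordField _ _) (hG₁.mlieBracket_coordField _ _)
    have k₂ := hD₂.koszul (hd₂ a.2) (hd₂ b.2) (hd₂ c.2) (hG₂.mlieBracket_coordField _ _)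
      (hG₂.mlieBracket_coordField _ _) (hG₂.mlieBracket_coordField _ _)
    rw [hi b c, hi a c, hi a b, (hm a).1, (hm a).2, (hm b).1, (hm b).2, (hm c).1, (hm c).2] at k
    rw [hF.inner_eq s, hs₁, hs₂, (hm c).1, (hm c).2]
    linarith
  rw [key]
  exact ⟨hs₁, hs₂⟩

variable [T2Space M] [T2Space P] [T2Space Q]

lemma IsProductIsometryAt.inner_covariantDerivative_covariantDerivative
    (hF : IsProductIsometryAt I I₁ I₂ f h x)
    (hD : IsLeviCivita D) (hD₁ : IsLeviCivita D₁) (hD₂ : IsLeviCivita D₂)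
    (hG₁ : IsCoordinateSystemAt I₁ G₁ (f x)) (hG₂ : IsCoordinateSystemAt I₂ G₂ (h x))
    (a b c d : E₁ × E₂) :
    inner ℝ (D (fun y ↦ D (coordField I (prodCoord f h G₁ G₂) c) y
        (coordField I (prodCoord f h G₁ G₂) b y)) x (coordField I (prodCoord f h G₁ G₂) a x))
        (coordField I (prodCoord f h G₁ G₂) d x) =
      inner ℝ (D₁ (fun y ↦ D₁ (coordField I₁ G₁ c.1) y (coordField I₁ G₁ b.1 y)) (f x)
        (coordField I₁ G₁ a.1 (f x))) (coordField I₁ G₁ d.1 (f x))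
      + inner ℝ (D₂ (fun y ↦ D₂ (coordField I₂ G₂ c.2) y (coordField I₂ G₂ b.2 y)) (h x)
        (coordField I₂ G₂ a.2 (h x))) (coordField I₂ G₂ d.2 (h x)) := by
  have hG := hF.isCoordinateSystemAt_prodCoord hG₁ hG₂
  have hs (c) := hG.smoothNear_coordField c
  have hs₁ (c) := hG₁.smoothNear_coordField c
  have hs₂ (c) := hG₂.smoothNear_coordField c
  have hm := hF.mfderiv_coordField_prodCoord hG₁ hG₂
  have hr : RelatedNear I I₁ I₂ f h
      (fun y ↦ D (coordField I (prodCoord f h G₁ G₂) c) y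
        (coordField I (prodCoord f h G₁ G₂) b y))
      (fun y ↦ D₁ (coordField I₁ G₁ c.1) y (coordField I₁ G₁ b.1 y))
      (fun y ↦ D₂ (coordField I₂ G₂ c.2) y (coordField I₂ G₂ b.2 y)) x := by
    filter_upwards [hF.eventually, hF.mdiffAt_fst.continuousAt.eventually hG₁.eventually,
      hF.mdiffAt_snd.continuousAt.eventually hG₂.eventually] with y hFy h₁ h₂
    exact hFy.mfderiv_covariantDerivative hD hD₁ hD₂ h₁ h₂ b c
  have hc := mdiffAt_covariantDerivative_apply hD.smooth (hs b).mdiffAt (hs c)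
  have hc₁ := mdiffAt_covariantDerivative_apply hD₁.smooth (hs₁ b.1).mdiffAt (hs₁ c.1)
  have hc₂ := mdiffAt_covariantDerivative_apply hD₂.smooth (hs₂ b.2).mdiffAt (hs₂ c.2)
  have e := hF.mvfderiv_inner hr (hF.relatedNear_coordField hG₁ hG₂ d) hc₁ (hs₁ d.1).mdiffAt
    hc₂ (hs₂ d.2).mdiffAt (coordField I (prodCoord f h G₁ G₂) a x)
  have e' := hF.inner_eq
    (D (coordField I (prodCoord f h G₁ G₂) c) x (coordField I (prodCoord f h G₁ G₂) b x))
    (D (coordField I (prodCoord f h G₁ G₂) d) x (coordField I (prodCoord f h G₁ G₂) a x))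
  have hbc := hF.mfderiv_covariantDerivative hD hD₁ hD₂ hG₁ hG₂ b c
  have had := hF.mfderiv_covariantDerivative hD hD₁ hD₂ hG₁ hG₂ a d
  rw [hbc.1, hbc.2, had.1, had.2] at e'
  rw [(hm a).1, (hm a).2, hD.metric x _ _ hc (hs d).mdiffAt,
    hD₁.metric _ _ _ hc₁ (hs₁ d.1).mdiffAt, hD₂.metric _ _ _ hc₂ (hs₂ d.2).mdiffAt] at e
  linarith

/-- The curvature tensor of a Riemannian product. -/
lemma IsProductIsometryAt.inner_curvature [I.Boundaryless] [I₁.Boundaryless] [I₂.Boundaryless]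
    (hF : IsProductIsometryAt I I₁ I₂ f h x)
    (hD : IsLeviCivita D) (hD₁ : IsLeviCivita D₁) (hD₂ : IsLeviCivita D₂)
    (u v w z : TangentSpace I x) :
    inner ℝ (curvature D x u v w) z =
      inner ℝ (curvature D₁ (f x) (mfderiv I I₁ f x u) (mfderiv I I₁ f x v)
        (mfderiv I I₁ f x w)) (mfderiv I I₁ f x z)
      + inner ℝ (curvature D₂ (h x) (mfderiv I I₂ h x u) (mfderiv I I₂ h x v)
        (mfderiv I I₂ h x w)) (mfderiv I I₂ h x z) := by
  have hG₁ := isCoordinateSystemAt_extChartAt (I := I₁) (f x)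
  have hG₂ := isCoordinateSystemAt_extChartAt (I := I₂) (h x)
  have hG := hF.isCoordinateSystemAt_prodCoord hG₁ hG₂
  have hs (c) := hG.smoothNear_coordField c
  have hs₁ (c) := hG₁.smoothNear_coordField c
  have hs₂ (c) := hG₂.smoothNear_coordField c
  have hm := hF.mfderiv_coordField_prodCoord hG₁ hG₂
  have hex (u : TangentSpace I x) : ∃ a : E₁ × E₂, coordField I
      (prodCoord f h (extChartAt I₁ (f x)) (extChartAt I₂ (h x))) a x = u :=
    ⟨_, hG.exists_coordField_eq u⟩
  obtain ⟨a, rfl⟩ := hex u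
  obtain ⟨b, rfl⟩ := hex v
  obtain ⟨c, rfl⟩ := hex w
  obtain ⟨d, rfl⟩ := hex z
  rw [(hm a).1, (hm a).2, (hm b).1, (hm b).2, (hm c).1, (hm c).2, (hm d).1, (hm d).2,
    hD.curvature_eq (hs a) (hs b) (hs c), hD₁.curvature_eq (hs₁ a.1) (hs₁ b.1) (hs₁ c.1),
    hD₂.curvature_eq (hs₂ a.2) (hs₂ b.2) (hs₂ c.2)]
  simp only [curvatureOp, hG.mlieBracket_coordField, hG₁.mlieBracket_coordField,
    hG₂.mlieBracket_coordField, map_zero, sub_zero, inner_sub_left]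
  rw [hF.inner_covariantDerivative_covariantDerivative hD hD₁ hD₂ hG₁ hG₂ a b c d,
    hF.inner_covariantDerivative_covariantDerivative hD hD₁ hD₂ hG₁ hG₂ b a c d]
  ring

end Product

end GoldenGeometry
section OrthogonalSum

variable {V V₁ V₂ : Type*} [NormedAddCommGroup V] [InnerProductSpace ℝ V]
  [NormedAddCommGroup V₁] [InnerProductSpace ℝ V₁]
  [NormedAddCommGroup V₂] [InnerProductSpace ℝ V₂] {A : V →L[ℝ] V₁} {B : V →L[ℝ] V₂}
  {ι : Type*} [Fintype ι] (b : OrthonormalBasis ι ℝ V)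

lemma OrthonormalBasis.sum_inner_sq_eq_inner (s : V) :
    ∑ i, inner ℝ (b i) s ^ 2 = inner ℝ s s := by
  rw [← b.sum_inner_mul_inner s s]
  refine Finset.sum_congr rfl fun i _ ↦ ?_
  rw [real_inner_comm (b i) s, sq]

lemma OrthonormalBasis.sum_inner_map_sq
    (hiso : ∀ u v : V, inner ℝ u v = inner ℝ (A u) (A v) + inner ℝ (B u) (B v))
    (hsurj : ∀ p : V₁, ∃ u, A u = p ∧ B u = 0) (p : V₁) :
    ∑ i, inner ℝ (A (b i)) p ^ 2 = inner ℝ p p := by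
  obtain ⟨s, rfl, hs⟩ := hsurj p
  have h (u : V) : inner ℝ (A u) (A s) = inner ℝ u s := by
    rw [hiso, hs, inner_zero_right, add_zero]
  simp only [h]
  exact b.sum_inner_sq_eq_inner s

lemma OrthonormalBasis.sum_inner_map_self [FiniteDimensional ℝ V₁]
    (hiso : ∀ u v : V, inner ℝ u v = inner ℝ (A u) (A v) + inner ℝ (B u) (B v))
    (hsurj : ∀ p : V₁, ∃ u, A u = p ∧ B u = 0) :
    ∑ i, inner ℝ (A (b i)) (A (b i)) = (Module.finrank ℝ V₁ : ℝ) := by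
  let c := stdOrthonormalBasis ℝ V₁
  have h (i) : inner ℝ (A (b i)) (A (b i)) = ∑ j, inner ℝ (A (b i)) (c j) ^ 2 := by
    rw [← c.sum_inner_sq_eq_inner]
    exact Finset.sum_congr rfl fun j _ ↦ by rw [real_inner_comm]
  simp only [h]
  rw [Finset.sum_comm]
  simp [b.sum_inner_map_sq hiso hsurj]

end OrthogonalSum

namespace GoldenGeometry

section SpaceForm

variable {E : Type*} [NormedAddCommGroup E] [NormedSpace ℝ E] [FiniteDimensional ℝ E]
  {H : Type*} [TopologicalSpace H] {I : ModelWithCorners ℝ E H} [I.Boundaryless]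
  {M : Type*} [TopologicalSpace M] [T2Space M] [ChartedSpace H M] [IsManifold I ∞ M]
  [RiemannianBundle (fun x : M ↦ TangentSpace I x)]
  [IsContMDiffRiemannianBundle I ∞ E (fun x : M ↦ TangentSpace I x)]
  {D : CovariantDerivative I E (fun x : M ↦ TangentSpace I x)}

lemma curvature_self_left (x : M) (u w : TangentSpace I x) : curvature D x u u w = 0 := by
  have h := curvature_swap (D := D) x u u w
  rwa [eq_neg_iff_add_eq_zero, ← two_smul ℝ, smul_eq_zero, or_iff_right two_ne_zero] at h

lemma inner_mul_inner_sub_sq_ne_zero {V : Type*} [NormedAddCommGroup V] [InnerProductSpace ℝ V]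
    {u v : V} (h : LinearIndependent ℝ ![u, v]) :
    inner ℝ u u * inner ℝ v v - inner ℝ u v ^ 2 ≠ 0 := by
  intro h0
  have hu : u ≠ 0 := h.ne_zero 0
  have huu : inner ℝ u u ≠ (0 : ℝ) := inner_self_ne_zero.2 hu
  refine (LinearIndependent.pair_iff' hu).1 h (inner ℝ u v / inner ℝ u u) ?_
  rw [eq_comm, ← sub_eq_zero, ← inner_self_eq_zero (𝕜 := ℝ)]
  simp only [inner_sub_left, inner_sub_right, real_inner_smul_left, real_inner_smul_right,
    real_inner_comm u v]
  field_simp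
  linarith [real_inner_comm u v]

lemma IsLeviCivita.inner_curvature_of_sectionalCurvature (hD : IsLeviCivita D) {c : ℝ} {x : M}
    (hc : ∀ u v : TangentSpace I x, LinearIndependent ℝ ![u, v] →
      sectionalCurvature D x u v = c) (u v : TangentSpace I x) :
    inner ℝ (curvature D x u v v) u = c * (inner ℝ u u * inner ℝ v v - inner ℝ u v ^ 2) := by
  by_cases hu : u = 0
  · simp [hu]
  by_cases hv : ∃ a : ℝ, a • u = v
  · obtain ⟨a, rfl⟩ := hv
    rw [hD.curvature_smul_middle, curvature_self_left]
    simp only [smul_zero, inner_zero_left, real_inner_smul_left, real_inner_smul_right]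
    ring
  · have hli : LinearIndependent ℝ ![u, v] := (LinearIndependent.pair_iff' hu).2 (by simpa using hv)
    have h := hc u v hli
    rw [sectionalCurvature, div_eq_iff (inner_mul_inner_sub_sq_ne_zero hli)] at h
    exact h

lemma IsLeviCivita.ricci_comm (hD : IsLeviCivita D) (x : M) (v w : TangentSpace I x) :
    ricci D x v w = ricci D x w v := by
  refine Finset.sum_congr rfl fun i _ ↦ ?_
  rw [hD.inner_curvature_pair_symm, curvature_swap, inner_neg_left, hD.inner_curvature_skew,
    neg_neg]

lemma IsLeviCivita.ricci_add_add (hD : IsLeviCivita D) (x : M) (v w : TangentSpace I x) :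
    ricci D x (v + w) (v + w) = ricci D x v v + 2 * ricci D x v w + ricci D x w w := by
  have h : ricci D x (v + w) (v + w) =
      ricci D x v v + ricci D x v w + (ricci D x w v + ricci D x w w) := by
    simp only [ricci, ← Finset.sum_add_distrib]
    refine Finset.sum_congr rfl fun i _ ↦ ?_
    rw [hD.curvature_add_middle, hD.curvature_add_right, hD.curvature_add_right]
    simp only [inner_add_left]
  rw [h, hD.ricci_comm x w v]
  ring

end SpaceForm

section RicciOfProduct

variable {E : Type*} [NormedAddCommGroup E] [NormedSpace ℝ E] [FiniteDimensional ℝ E]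
  {H : Type*} [TopologicalSpace H] {I : ModelWithCorners ℝ E H} [I.Boundaryless]
  {E₁ : Type*} [NormedAddCommGroup E₁] [NormedSpace ℝ E₁] [FiniteDimensional ℝ E₁]
  {H₁ : Type*} [TopologicalSpace H₁] {I₁ : ModelWithCorners ℝ E₁ H₁} [I₁.Boundaryless]
  {E₂ : Type*} [NormedAddCommGroup E₂] [NormedSpace ℝ E₂] [FiniteDimensional ℝ E₂]
  {H₂ : Type*} [TopologicalSpace H₂] {I₂ : ModelWithCorners ℝ E₂ H₂} [I₂.Boundaryless]
  {M : Type*} [TopologicalSpace M] [T2Space M] [ChartedSpace H M] [IsManifold I ∞ M]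
  [RiemannianBundle (fun x : M ↦ TangentSpace I x)]
  [IsContMDiffRiemannianBundle I ∞ E (fun x : M ↦ TangentSpace I x)]
  {P : Type*} [TopologicalSpace P] [T2Space P] [ChartedSpace H₁ P] [IsManifold I₁ ∞ P]
  [RiemannianBundle (fun x : P ↦ TangentSpace I₁ x)]
  [IsContMDiffRiemannianBundle I₁ ∞ E₁ (fun x : P ↦ TangentSpace I₁ x)]
  {Q : Type*} [TopologicalSpace Q] [T2Space Q] [ChartedSpace H₂ Q] [IsManifold I₂ ∞ Q]
  [RiemannianBundle (fun x : Q ↦ TangentSpace I₂ x)]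
  [IsContMDiffRiemannianBundle I₂ ∞ E₂ (fun x : Q ↦ TangentSpace I₂ x)]
  {f : M → P} {h : M → Q} {x : M} {cp cq : ℝ}
  {D : CovariantDerivative I E (fun x : M ↦ TangentSpace I x)}

/-- The Ricci tensor of a Riemannian product of real space forms. -/
lemma IsProductIsometryAt.ricci_eq (hF : IsProductIsometryAt I I₁ I₂ f h x)
    (hD : IsLeviCivita D) (hP : IsRealSpaceForm I₁ P cp) (hQ : IsRealSpaceForm I₂ Q cq)
    (v w : TangentSpace I x) :
    ricci D x v w =
      cp * (Module.finrank ℝ E₁ - 1) * inner ℝ (mfderiv I I₁ f x v) (mfderiv I I₁ f x w)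
      + cq * (Module.finrank ℝ E₂ - 1) * inner ℝ (mfderiv I I₂ h x v) (mfderiv I I₂ h x w) := by
  obtain ⟨D₁, hD₁, hc₁⟩ := hP
  obtain ⟨D₂, hD₂, hc₂⟩ := hQ
  have : FiniteDimensional ℝ (TangentSpace I x) := inferInstanceAs (FiniteDimensional ℝ E)
  have : FiniteDimensional ℝ (TangentSpace I₁ (f x)) := inferInstanceAs (FiniteDimensional ℝ E₁)
  have : FiniteDimensional ℝ (TangentSpace I₂ (h x)) := inferInstanceAs (FiniteDimensional ℝ E₂)
  let b := stdOrthonormalBasis ℝ (TangentSpace I x)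
  have hsurj₁ (p : TangentSpace I₁ (f x)) := hF.exists_mfderiv_eq p 0
  have hsurj₂ (q : TangentSpace I₂ (h x)) :
      ∃ u : TangentSpace I x, mfderiv I I₂ h x u = q ∧ mfderiv I I₁ f x u = 0 :=
    (hF.exists_mfderiv_eq 0 q).imp fun _ hu ↦ hu.symm
  have hiso' (u v : TangentSpace I x) := (hF.inner_eq u v).trans (add_comm _ _)
  have hn₁ := b.sum_inner_map_self hF.inner_eq hsurj₁
  have hn₂ := b.sum_inner_map_self hiso' hsurj₂
  have hdiag (v : TangentSpace I x) : ricci D x v v =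
      cp * (Module.finrank ℝ E₁ - 1) * inner ℝ (mfderiv I I₁ f x v) (mfderiv I I₁ f x v)
      + cq * (Module.finrank ℝ E₂ - 1) * inner ℝ (mfderiv I I₂ h x v) (mfderiv I I₂ h x v) := by
    have hs₁ := b.sum_inner_map_sq hF.inner_eq hsurj₁ (mfderiv I I₁ f x v)
    have hs₂ := b.sum_inner_map_sq hiso' hsurj₂ (mfderiv I I₂ h x v)
    change ∑ i, inner ℝ (curvature D x (b i) v v) (b i) = _
    have e (i) : inner ℝ (curvature D x (b i) v v) (b i) =
        cp * (inner ℝ (mfderiv I I₁ f x (b i)) (mfderiv I I₁ f x (b i))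
            * inner ℝ (mfderiv I I₁ f x v) (mfderiv I I₁ f x v)
          - inner ℝ (mfderiv I I₁ f x (b i)) (mfderiv I I₁ f x v) ^ 2)
        + cq * (inner ℝ (mfderiv I I₂ h x (b i)) (mfderiv I I₂ h x (b i))
            * inner ℝ (mfderiv I I₂ h x v) (mfderiv I I₂ h x v)
          - inner ℝ (mfderiv I I₂ h x (b i)) (mfderiv I I₂ h x v) ^ 2) := by
      rw [hF.inner_curvature hD hD₁ hD₂,
        hD₁.inner_curvature_of_sectionalCurvature (hc₁ (f x)),
        hD₂.inner_curvature_of_sectionalCurvature (hc₂ (h x))]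
    simp only [e]
    rw [Finset.sum_add_distrib, ← Finset.mul_sum, ← Finset.mul_sum, Finset.sum_sub_distrib,
      Finset.sum_sub_distrib, ← Finset.sum_mul, ← Finset.sum_mul, hn₁, hn₂, hs₁, hs₂]
    change cp * ((Module.finrank ℝ E₁ : ℝ) * _ - _) + cq * ((Module.finrank ℝ E₂ : ℝ) * _ - _) = _
    ring
  have hadd := hD.ricci_add_add x v w
  rw [hdiag, hdiag, hdiag] at hadd
  simp only [map_add, inner_add_left, inner_add_right] at hadd
  rw [real_inner_comm (mfderiv I I₁ f x v) (mfderiv I I₁ f x w),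
    real_inner_comm (mfderiv I I₂ h x v) (mfderiv I I₂ h x w)] at hadd
  linarith

/-- On a locally Golden product of real space forms, the Ricci tensor is a combination with
constant coefficients of `g` and `g(φ ·, ·)`. -/
lemma IsLocallyGoldenProduct.exists_ricci_eq
    {φ : Π x : M, TangentSpace I x →L[ℝ] TangentSpace I x}
    (hM : IsLocallyGoldenProduct I I₁ I₂ P Q φ)
    (hP : IsRealSpaceForm I₁ P cp) (hQ : IsRealSpaceForm I₂ Q cq) (hD : IsLeviCivita D) :
    ∃ a b : ℝ, ∀ (x : M) (v w : TangentSpace I x),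
      ricci D x v w = a * inner ℝ v w + b * inner ℝ (φ x v) w := by
  set α : ℝ := cp * (Module.finrank ℝ E₁ - 1)
  set β : ℝ := cq * (Module.finrank ℝ E₂ - 1)
  have hk : 2 * Real.goldenRatio - 1 ≠ 0 := by linarith [Real.one_lt_goldenRatio]
  refine ⟨(β * Real.goldenRatio - α * (1 - Real.goldenRatio)) / (2 * Real.goldenRatio - 1),
    (α - β) / (2 * Real.goldenRatio - 1), fun x v w ↦ ?_⟩
  obtain ⟨f, h, hdiff, hiso⟩ := hM x
  have hF : IsProductIsometryAt I I₁ I₂ f h x := ⟨hdiff, hiso.mono fun _ hy ↦ hy.1⟩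
  rw [hF.ricci_eq hD hP hQ, hF.inner_eq v w, hF.inner_eq (φ x v) w,
    (hiso.self_of_nhds.2 v).1, (hiso.self_of_nhds.2 v).2, real_inner_smul_left,
    real_inner_smul_left]
  field_simp
  ring

end RicciOfProduct

end GoldenGeometry

theorem mainTheorem8
    {E : Type*} [NormedAddCommGroup E] [NormedSpace ℝ E] [FiniteDimensional ℝ E]
    {H : Type*} [TopologicalSpace H] (I : ModelWithCorners ℝ E H) [I.Boundaryless]
    {E₁ : Type*} [NormedAddCommGroup E₁] [NormedSpace ℝ E₁] [FiniteDimensional ℝ E₁]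
    {H₁ : Type*} [TopologicalSpace H₁] (I₁ : ModelWithCorners ℝ E₁ H₁) [I₁.Boundaryless]
    {E₂ : Type*} [NormedAddCommGroup E₂] [NormedSpace ℝ E₂] [FiniteDimensional ℝ E₂]
    {H₂ : Type*} [TopologicalSpace H₂] (I₂ : ModelWithCorners ℝ E₂ H₂) [I₂.Boundaryless]
    -- the Riemannian manifold `(M, g)`
    {M : Type*} [TopologicalSpace M] [T2Space M] [ChartedSpace H M] [IsManifold I ∞ M]
    [RiemannianBundle (fun x : M ↦ TangentSpace I x)]
    [IsContMDiffRiemannianBundle I ∞ E (fun x : M ↦ TangentSpace I x)]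
    -- the factors `M_p` and `M_q`
    {P : Type*} [TopologicalSpace P] [T2Space P] [ChartedSpace H₁ P] [IsManifold I₁ ∞ P]
    [RiemannianBundle (fun x : P ↦ TangentSpace I₁ x)]
    [IsContMDiffRiemannianBundle I₁ ∞ E₁ (fun x : P ↦ TangentSpace I₁ x)]
    {Q : Type*} [TopologicalSpace Q] [T2Space Q] [ChartedSpace H₂ Q] [IsManifold I₂ ∞ Q]
    [RiemannianBundle (fun x : Q ↦ TangentSpace I₂ x)]
    [IsContMDiffRiemannianBundle I₂ ∞ E₂ (fun x : Q ↦ TangentSpace I₂ x)]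
    (cp cq : ℝ)
    (hP : GoldenGeometry.IsRealSpaceForm I₁ P cp)
    (hQ : GoldenGeometry.IsRealSpaceForm I₂ Q cq)
    (φ : Π x : M, TangentSpace I x →L[ℝ] TangentSpace I x)
    (hφ : GoldenGeometry.IsGoldenStructure φ)
    (hM : GoldenGeometry.IsLocallyGoldenProduct I I₁ I₂ P Q φ)
    (D : CovariantDerivative I E (fun x : M ↦ TangentSpace I x))
    (hD : GoldenGeometry.IsLeviCivita D)
    (hint : GoldenGeometry.IsIntegrable D φ) :
    GoldenGeometry.IsRicciSymmetric D := by
  obtain ⟨a, b, hab⟩ := hM.exists_ricci_eq hP hQ hD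
  intro x X Y hX hY
  have hφX : MDiffAt (T% (fun y ↦ φ y (X y))) x :=
    MDifferentiableAt.clm_bundle_apply ((hφ.smooth x).mdifferentiableAt (by simp)) hX
  have h₁ := GoldenGeometry.mdiffAt_inner hX hY
  have h₂ := GoldenGeometry.mdiffAt_inner hφX hY
  have h₁' : MDiffAt (fun y ↦ a * inner ℝ (X y) (Y y)) x :=
    (mdifferentiableAt_const (I := I) (I' := 𝓘(ℝ, ℝ)) (c := a) (x := x)).mul h₁
  have h₂' : MDiffAt (fun y ↦ b * inner ℝ (φ y (X y)) (Y y)) x :=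
    (mdifferentiableAt_const (I := I) (I' := 𝓘(ℝ, ℝ)) (c := b) (x := x)).mul h₂
  simp only [hab]
  refine ⟨h₁'.add h₂', fun w ↦ ?_⟩
  rw [mvfderiv_fun_add h₁' h₂', mvfderiv_fun_mul mdifferentiableAt_const h₁,
    mvfderiv_fun_mul mdifferentiableAt_const h₂, mvfderiv_const, mvfderiv_const]
  simp only [smul_zero, add_zero, add_apply, smul_apply, smul_eq_mul]
  rw [hD.metric x X Y hX hY w, hD.metric x _ Y hφX hY w, hint x X hX w]
  ring
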